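/- Let $\mathbb F$ be an infinite field with $\operatorname{char}\mathbb F\neq 2$ and let $d\ge 0$. Consider nonempty words in the letters $1,\dots,d,1^T,\dots,d^T$, with the involution $(\alpha_1\cdots\alpha_p)^T=\alpha_p^T\cdots\alpha_1^T$ (where $(i^T)^T=i$). A nonempty word is primitive if it is not a power of a shorter word; write $\alpha\sim\beta$ if some cyclic rotation of $\alpha$ equals $\beta$ or $\beta^T$. Let $\mathcal N_\sigma$ be the commutative polynomial algebra over $\mathbb F$ freely generated by symbols $\sigma_t(\alpha)$, where $t>0$ is an integer and $\alpha$ ranges over the $\sim$-classes of primitive words, graded by $\deg\sigma_t(\alpha)=t\deg\alpha$, where $\deg\alpha$ is the length of $\alpha$. For $n\geq 1$ let $X_1,\dots,X_d$ be generic $n\times n$ matrices, $R_n$ the polynomial ring over $\mathbb F$ in their entries, and for a word $\alpha$ let $X_\alpha$ be the corresponding product of generic matrices and their transposes. For an $n\times n$ matrix $A$ define $\sigma_t(A)$ by $\det(A+\lambda E)=\sum_{t=0}^n\lambda^{n-t}\sigma_t(A)$. Let $R^{O(n)}\subseteq R_n$ be the subalgebra generated by all $\sigma_t(X_\alpha)$,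 $1\le t\le n$, $\alpha$ a nonempty word. Let $\Psi_n:\mathcal N_\sigma\to R^{O(n)}$ be the algebra homomorphism with $\sigma_t(\alpha)\mapsto\sigma_t(X_\alpha)$ if $t\le n$ and $\sigma_t(\alpha)\mapsto 0$ if $t>n$. The elements of $\bigcap_{n>0}\ker\Psi_n$ are called free relations. An element of $\mathcal N_\sigma$ is called decomposable if it lies in the $\mathbb F$-span of the products of two homogeneous elements of positive degree. Then the following hold. 1. If $\operatorname{char}\mathbb F=p>0$, every free relation lies in the ideal of $\mathcal N_\sigma$ generated by the elements $\sigma_t(\alpha)^p$, where $\alpha$ is primitive and $t>0$. 2. If $\operatorname{char}\mathbb F=0$, the only free relation is $0$. 3. In particular, there are no nonzero linear free relations between indecomposable invariants: every free relation is decomposable (i.e. it is zero modulo the decomposable elements of $\mathcal N_\sigma$), and a free relation that is an $\mathbb F$-linear combination of the symbols $\sigma_t(\alpha)$ is $0$. -/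

import Mathlib

noncomputable section

namespace OInv

/-! ### Words and primitive words -/

/-- The letters `1, …, d, 1ᵀ, …, dᵀ`: `(i, false)` is the letter `i`, `(i, true)` is `iᵀ`. -/
abbrev Letter (d : ℕ) : Type := Fin d × Bool

/-- The transpose of a letter. -/
def Letter.tr {d : ℕ} (b : Letter d) : Letter d := (b.1, !b.2)

/-- Words in the letters. The free monoid without unity consists of the nonempty words. -/
abbrev Word (d : ℕ) : Type := List (Letter d)

/-- The involution `(α₁ ⋯ αₚ)ᵀ = αₚᵀ ⋯ α₁ᵀ` on words. -/
def Word.tr {d : ℕ} (w : Word d) : Word d := (w.map Letter.tr).reverse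

/-- The `l`-th power of a word. -/
def Word.pow {d : ℕ} (w : Word d) (l : ℕ) : Word d := (List.replicate l w).flatten

/-- A nonempty word is primitive if it is not a power of a shorter word. -/
def Word.Primitive {d : ℕ} (w : Word d) : Prop :=
  w ≠ [] ∧ ∀ u : Word d, u.length < w.length → ∀ l : ℕ, w ≠ u.pow l

/-- `α ∼ β` if some cyclic rotation of `α` equals `β` or `βᵀ`. -/
def Word.Equivalent {d : ℕ} (a b : Word d) : Prop :=
  List.IsRotated a b ∨ List.IsRotated a b.tr

theorem Letter.tr_tr {d : ℕ} (b : Letter d) : b.tr.tr = b := by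
  simp [Letter.tr]

theorem Word.tr_tr {d : ℕ} (w : Word d) : Word.tr (Word.tr w) = w := by
  have h : (Letter.tr ∘ Letter.tr : Letter d → Letter d) = id := funext Letter.tr_tr
  simp [Word.tr, h]

theorem Word.tr_isRotated {d : ℕ} {a b : Word d} (h : List.IsRotated a b) :
    List.IsRotated (Word.tr a) (Word.tr b) :=
  (h.map Letter.tr).reverse

theorem Word.equivalent_equivalence (d : ℕ) : Equivalence (Word.Equivalent (d := d)) where
  refl a := Or.inl (List.IsRotated.refl a)
  symm := by
    rintro a b (h | h)
    · exact Or.inl h.symm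
    · refine Or.inr ?_
      have h2 := Word.tr_isRotated h
      rw [Word.tr_tr] at h2
      exact h2.symm
  trans := by
    rintro a b c (h | h) (k | k)
    · exact Or.inl (h.trans k)
    · exact Or.inr (h.trans k)
    · exact Or.inr (h.trans (Word.tr_isRotated k))
    · refine Or.inl (h.trans ?_)
      have h2 := Word.tr_isRotated k
      rwa [Word.tr_tr] at h2

theorem Word.Equivalent.length_eq {d : ℕ} {a b : Word d} (h : a.Equivalent b) :
    a.length = b.length := by
  rcases h with h | h
  · exact h.perm.length_eq
  · simpa [Word.tr] using h.perm.length_eq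

/-- The set of primitive words. -/
abbrev Prim (d : ℕ) : Type := {w : Word d // w.Primitive}

/-- The relation `∼` on primitive words. -/
instance primSetoid (d : ℕ) : Setoid (Prim d) where
  r a b := Word.Equivalent a.1 b.1
  iseqv :=
    { refl := fun a => (Word.equivalent_equivalence d).refl a.1
      symm := fun h => (Word.equivalent_equivalence d).symm h
      trans := fun h k => (Word.equivalent_equivalence d).trans h k }

/-- The `∼`-equivalence classes of primitive words. -/
def PrimClass (d : ℕ) : Type := Quotient (primSetoid d)

/-- The class of a primitive word. -/
def PrimClass.mk {d : ℕ} (a : Prim d) : PrimClass d := Quotient.mk (primSetoid d) a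

/-- The degree (length) of a class of primitive words. -/
def PrimClass.deg {d : ℕ} (c : PrimClass d) : ℕ :=
  Quotient.lift (fun a : Prim d => a.1.length)
    (fun _ _ h => Word.Equivalent.length_eq h) c

/-! ### The free commutative algebra on the symbols `σ_t(α)` -/

/-- `N_σ`: polynomials over `F` in the symbols `σ_t(α)`, where `t > 0` and `α` ranges over the
`∼`-equivalence classes of primitive words. -/
abbrev NSigma (F : Type*) [Field F] (d : ℕ) : Type _ :=
  MvPolynomial (ℕ+ × PrimClass d) F

/-- The free generator `σ_t(α)` of `N_σ`. -/
def NSigma.gen (F : Type*) [Field F] {d : ℕ} (t : ℕ+) (a : Prim d) : NSigma F d :=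
  MvPolynomial.X (t, PrimClass.mk a)

/-- The degree `deg σ_t(α) = t deg α` of a free generator. -/
def genDeg {d : ℕ} (q : ℕ+ × PrimClass d) : ℕ := (q.1 : ℕ) * q.2.deg

/-- `f ∈ N_σ` is homogeneous of degree `m`. -/
def NSigma.IsHomog {F : Type*} [Field F] {d : ℕ} (f : NSigma F d) (m : ℕ) : Prop :=
  MvPolynomial.IsWeightedHomogeneous genDeg f m

/-- The decomposable elements of `N_σ`: the span of the products of two homogeneous elements of
positive degree. -/
def decomposables (F : Type*) [Field F] (d : ℕ) : Submodule F (NSigma F d) :=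
  Submodule.span F {f | ∃ (g h : NSigma F d) (a b : ℕ), 0 < a ∧ 0 < b ∧
    g.IsHomog a ∧ h.IsHomog b ∧ f = g * h}

/-! ### Generic matrices and matrix `O(n)`-invariants -/

/-- `det (A + λ E)` as a polynomial in `λ`. -/
def sigmaPoly {S : Type*} [CommRing S] {n : ℕ} (A : Matrix (Fin n) (Fin n) S) : Polynomial S :=
  (A.map Polynomial.C + (Polynomial.X : Polynomial S) • 1).det

/-- `σ_t(A)` for `t ≤ n`: the coefficient of `λ ^ (n - t)` in `det (A + λ E)`.
(It is only used for `t ≤ n`.) -/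
def sigma {S : Type*} [CommRing S] {n : ℕ} (t : ℕ) (A : Matrix (Fin n) (Fin n) S) : S :=
  (sigmaPoly A).coeff (n - t)

/-- The ring `R_n` of polynomials in the variables `x_{ij}(k)`; the variable `x_{ij}(k)` has
index `(k, i, j)`. -/
abbrev GenRing (F : Type*) [Field F] (n d : ℕ) : Type _ :=
  MvPolynomial (Fin d × Fin n × Fin n) F

/-- The generic matrix `X_k`. -/
def genericMatrix (F : Type*) [Field F] (n : ℕ) {d : ℕ} (k : Fin d) :
    Matrix (Fin n) (Fin n) (GenRing F n d) :=
  Matrix.of fun i j => MvPolynomial.X (k, i, j)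

/-- The matrix `X_β` of a letter: `X_i` for `β = i` and `X_iᵀ` for `β = iᵀ`. -/
def letterMatrix (F : Type*) [Field F] (n : ℕ) {d : ℕ} (b : Letter d) :
    Matrix (Fin n) (Fin n) (GenRing F n d) :=
  if b.2 then (genericMatrix F n b.1).transpose else genericMatrix F n b.1

/-- The matrix `X_α = X_{α₁} ⋯ X_{αₚ}` of a word. -/
def wordMatrix (F : Type*) [Field F] (n : ℕ) {d : ℕ} (w : Word d) :
    Matrix (Fin n) (Fin n) (GenRing F n d) :=
  (w.map (letterMatrix F n)).prod

/-- The algebra of matrix `O(n)`-invariants: the subalgebra of `R_n` generated by all `σ_t(A)`,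
`1 ≤ t ≤ n`, where `A` is a monomial in the generic matrices and their transposes. -/
def matrixInvariants (F : Type*) [Field F] (n d : ℕ) : Subalgebra F (GenRing F n d) :=
  Algebra.adjoin F {f | ∃ (t : ℕ) (w : Word d), 1 ≤ t ∧ t ≤ n ∧ w ≠ [] ∧
    f = sigma t (wordMatrix F n w)}

theorem sigmaPoly_eq_charpoly {S : Type*} [CommRing S] {n : ℕ} (A : Matrix (Fin n) (Fin n) S) :
    sigmaPoly A = (-A).charpoly := by
  unfold sigmaPoly Matrix.charpoly
  congr 1
  ext1 i j
  by_cases h : i = j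
  · subst h
    simp [add_comm]
  · simp [h]

theorem sigma_mul_comm {S : Type*} [CommRing S] {n : ℕ} (t : ℕ)
    (A B : Matrix (Fin n) (Fin n) S) : sigma t (A * B) = sigma t (B * A) := by
  unfold sigma
  rw [sigmaPoly_eq_charpoly, sigmaPoly_eq_charpoly, ← Matrix.neg_mul, Matrix.charpoly_mul_comm,
    Matrix.mul_neg]

theorem sigma_transpose {S : Type*} [CommRing S] {n : ℕ} (t : ℕ)
    (A : Matrix (Fin n) (Fin n) S) : sigma t A.transpose = sigma t A := by
  unfold sigma
  rw [sigmaPoly_eq_charpoly, sigmaPoly_eq_charpoly, ← Matrix.transpose_neg,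
    Matrix.charpoly_transpose]

theorem letterMatrix_tr (F : Type*) [Field F] (n : ℕ) {d : ℕ} (b : Letter d) :
    letterMatrix F n b.tr = (letterMatrix F n b).transpose := by
  obtain ⟨i, c⟩ := b
  cases c <;> simp [letterMatrix, Letter.tr]

theorem wordMatrix_tr (F : Type*) [Field F] (n : ℕ) {d : ℕ} (w : Word d) :
    wordMatrix F n w.tr = (wordMatrix F n w).transpose := by
  unfold wordMatrix Word.tr
  rw [Matrix.transpose_list_prod, List.map_reverse, List.map_map, List.map_map]
  congr 2
  exact List.map_congr_left fun b _ => letterMatrix_tr F n b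

theorem sigma_isRotated (F : Type*) [Field F] (n : ℕ) {d : ℕ} (t : ℕ) {a b : Word d}
    (h : List.IsRotated a b) : sigma t (wordMatrix F n a) = sigma t (wordMatrix F n b) := by
  obtain ⟨k, hk, rfl⟩ := List.isRotated_iff_mod.1 h
  rw [List.rotate_eq_drop_append_take hk]
  conv_lhs => rw [← List.take_append_drop k a]
  simp only [wordMatrix, List.map_append, List.prod_append]
  exact sigma_mul_comm t _ _

theorem sigma_equivalent (F : Type*) [Field F] (n : ℕ) {d : ℕ} (t : ℕ) {a b : Word d}
    (h : a.Equivalent b) : sigma t (wordMatrix F n a) = sigma t (wordMatrix F n b) := by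
  rcases h with h | h
  · exact sigma_isRotated F n t h
  · rw [sigma_isRotated F n t h, wordMatrix_tr, sigma_transpose]

/-- The image of the symbol `σ_t(α)` in the algebra of invariants: `σ_t(X_α)` if `t ≤ n`, and
`0` otherwise. -/
def genImage (F : Type*) [Field F] (n : ℕ) {d : ℕ} (q : ℕ+ × PrimClass d) :
    matrixInvariants F n d :=
  Quotient.lift
    (fun a : Prim d =>
      if h : (q.1 : ℕ) ≤ n then
        (⟨sigma q.1 (wordMatrix F n a.1),
          Algebra.subset_adjoin ⟨q.1, a.1, q.1.pos, h, a.2.1, rfl⟩⟩ : matrixInvariants F n d)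
      else 0)
    (fun a b hab => by
      have hs := sigma_equivalent F n q.1 (show Word.Equivalent a.1 b.1 from hab)
      simp only [hs])
    q.2

/-- The homomorphism `Ψ_n : N_σ → R^{O(n)}`. -/
def Psi (F : Type*) [Field F] (n d : ℕ) : NSigma F d →ₐ[F] matrixInvariants F n d :=
  MvPolynomial.aeval (genImage F n)

/-- The ideal `K_n` of relations for `R^{O(n)}`. -/
def relations (F : Type*) [Field F] (n d : ℕ) : Ideal (NSigma F d) :=
  RingHom.ker (Psi F n d)

/-- The ideal `⋂_{n > 0} K_n` of free relations. -/
def freeRelations (F : Type*) [Field F] (d : ℕ) : Ideal (NSigma F d) :=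
  ⨅ (n : ℕ) (_ : 0 < n), relations F n d

end OInv

end

noncomputable section

namespace OInv

/-! ### Periodic words -/

/-! Every free relation is zero whenever `2 ≠ 0` in the field, in positive characteristic too, and
all the claims follow from this. A free relation `f` involves finitely many symbols, so it suffices
to give these symbols arbitrary values, in an algebraically closed field, by means of matrices with
`Y_{iᵀ} = Y_iᵀ`; giving each symbol its own image in a field containing `N_σ` then forces `f = 0`.
Matrices are built from cycles: on a cycle labelled by a primitive word `a`, `det (1 + z M_w)` is `1
+ y z` if `w` is a rotation of `a`, and is `1` for other primitive `w`, because `M_w` is then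
nilpotent (`detOneAdd_cycleMatrix`). Block sums multiply these determinants, so any polynomial with
constant term `1` can be attached to each class (`Realizable.polynomial`). Doubling the size
restores the transpose condition and replaces `G w` by `G w * G wᵀ` (`exists_orthogonal_family`). If
`a` is a rotation of `aᵀ`, this squares the polynomial, which is undone by a truncated square root;
here `2 ≠ 0` is needed again. -/

/-- The word `s i, s (i + 1), …, s (i + n - 1)` read along the cycle `ZMod k`. -/
def walk {α : Type*} {k : ℕ} (s : ZMod k → α) : ZMod k → ℕ → List α
  | _, 0 => []
  | i, n + 1 => s i :: walk s (i + 1) n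

section Walk

variable {α : Type*} {k : ℕ} (s : ZMod k → α)

@[simp]
theorem length_walk (i : ZMod k) (n : ℕ) : (walk s i n).length = n := by
  induction n generalizing i with
  | zero => rfl
  | succ n ih => simp [walk, ih]

theorem walk_add (i : ZMod k) (m n : ℕ) :
    walk s i (m + n) = walk s i m ++ walk s (i + m) n := by
  induction m generalizing i with
  | zero => simp [walk]
  | succ m ih =>
    rw [Nat.add_right_comm, walk, ih, walk, List.cons_append, Nat.cast_succ,
      add_right_comm i 1, add_assoc i]

theorem getElem_walk (i : ZMod k) (n t : ℕ) (h : t < (walk s i n).length) :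
    (walk s i n)[t] = s (i + t) := by
  induction n generalizing i t with
  | zero => simp at h
  | succ n ih =>
    cases t with
    | zero => simp [walk]
    | succ t =>
      simp only [walk, List.getElem_cons_succ]
      rw [ih]
      push_cast
      congr 1
      ring

theorem walk_eq_walk_iff (i j : ZMod k) (n : ℕ) :
    walk s i n = walk s j n ↔ ∀ t < n, s (i + t) = s (j + t) := by
  constructor
  · intro h t ht
    rw [← getElem_walk s i n t (by simpa), ← getElem_walk s j n t (by simpa)]
    simp only [h]
  · intro h
    refine List.ext_getElem (by simp) fun t h₁ h₂ => ?_
    rw [getElem_walk, getElem_walk]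
    exact h t (by simpa using h₁)

theorem walk_mul_of_period (g : ℕ) (hg : ∀ j, s (j + g) = s j) (i : ZMod k) (c : ℕ) :
    walk s i (c * g) = (List.replicate c (walk s i g)).flatten := by
  induction c with
  | zero => simp [walk]
  | succ c ih =>
    have h : walk s (i + g) (c * g) = walk s i (c * g) := by
      rw [walk_eq_walk_iff]
      intro t _
      rw [add_right_comm, hg]
    rw [Nat.succ_mul, add_comm, walk_add, h, ih, List.replicate_succ, List.flatten_cons]

theorem isRotated_walk [NeZero k] (i : ZMod k) : List.IsRotated (walk s 0 k) (walk s i k) := by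
  have hi := i.val_lt
  obtain ⟨r, hr⟩ := Nat.exists_eq_add_of_lt hi
  have hk : k = i.val + (r + 1) := by omega
  have hir : i + ((r + 1 : ℕ) : ZMod k) = 0 := by
    have : ((i.val + (r + 1) : ℕ) : ZMod k) = 0 := by rw [← hk]; simp
    rwa [Nat.cast_add, ZMod.natCast_zmod_val] at this
  have h1 : walk s 0 k = walk s 0 i.val ++ walk s i (r + 1) := by
    -- Only the length may be rewritten, since `k` is also the modulus of `ZMod k`.
    conv_lhs => rw [show walk s 0 k = walk s 0 (i.val + (r + 1)) from congrArg _ hk]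
    rw [walk_add, zero_add, ZMod.natCast_zmod_val]
  have h2 : walk s i k = walk s i (r + 1) ++ walk s 0 i.val := by
    conv_lhs => rw [show walk s i k = walk s i ((r + 1) + i.val) from
      congrArg _ (hk.trans (add_comm _ _))]
    rw [walk_add, hir]
  rw [h1, h2]
  exact List.isRotated_append

theorem exists_walk_of_isRotated {b : List α} (h : List.IsRotated (walk s 0 k) b) :
    ∃ i, walk s i k = b := by
  obtain ⟨n, hn, rfl⟩ := List.isRotated_iff_mod.1 h
  rw [length_walk] at hn
  obtain ⟨r, hr⟩ := Nat.exists_eq_add_of_le hn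
  have hir : (n : ZMod k) + (r : ZMod k) = 0 := by
    rw [← Nat.cast_add, ← hr]; simp
  refine ⟨n, ?_⟩
  have h1 : walk s 0 k = walk s 0 n ++ walk s n r := by
    conv_lhs => rw [show walk s 0 k = walk s 0 (n + r) from congrArg _ hr]
    rw [walk_add, zero_add]
  have h2 : walk s n k = walk s n r ++ walk s 0 n := by
    conv_lhs => rw [show walk s n k = walk s n (r + n) from
      congrArg _ (hr.trans (add_comm _ _))]
    rw [walk_add, hir]
  have h3 := List.rotate_append_length_eq (walk s 0 n) (walk s n r)
  rw [length_walk] at h3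
  rw [h1, h2, h3]

end Walk

theorem exists_walk_eq {α : Type*} (a : List α) (ha : a ≠ []) :
    ∃ s : ZMod a.length → α, walk s 0 a.length = a := by
  have hk : 0 < a.length := List.length_pos_of_ne_nil ha
  have : NeZero a.length := ⟨hk.ne'⟩
  refine ⟨fun j => a[j.val]'j.val_lt, List.ext_getElem (by simp) fun t h₁ h₂ => ?_⟩
  rw [getElem_walk]
  simp only [zero_add, ZMod.val_cast_of_lt h₂]

/-! ### Periods of primitive cyclic words -/

section Primitive

variable {d k : ℕ} {s : ZMod k → Letter d}

/-- A period `g` dividing the length makes the word a power of its initial segment of length `g`. -/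
theorem Word.Primitive.dvd_of_walk_eq {i : ZMod k} {n g : ℕ}
    (hw : Word.Primitive (walk s i n)) (hgn : g ∣ n) (hg : ∀ j, s (j + g) = s j) : g = n := by
  obtain ⟨c, rfl⟩ := hgn
  by_contra hne
  have hpos : 0 < g * c := by
    rw [← length_walk s i (g * c)]
    exact List.length_pos_of_ne_nil hw.1
  refine hw.2 (walk s i g) ?_ c ?_
  · simpa using lt_of_le_of_ne (Nat.le_mul_of_pos_right g (Nat.pos_of_mul_pos_left hpos)) hne
  · rw [mul_comm]
    exact walk_mul_of_period s g hg i c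

variable [NeZero k]

/-- A primitive cyclic word has no nontrivial period. -/
theorem eq_zero_of_period (hw : Word.Primitive (walk s 0 k)) (u : ZMod k)
    (hu : ∀ j, s (j + u) = s j) : u = 0 := by
  have hmul : ∀ m : ℕ, ∀ j, s (j + m * u) = s j := by
    intro m
    induction m with
    | zero => simp
    | succ m ih =>
      intro j
      rw [Nat.cast_succ, add_mul, one_mul, ← add_assoc, hu, ih]
  -- By Bézout the gcd of `u` and `k` is a multiple of `u` modulo `k`, hence a period that divides
  -- `k`.
  have hgcd : ((Nat.gcd u.val k : ℕ) : ZMod k) = ((Nat.gcdA u.val k : ZMod k).val : ZMod k) * u := by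
    have h := congrArg (Int.cast : ℤ → ZMod k) (Nat.gcd_eq_gcd_ab u.val k)
    push_cast at h
    rw [h]
    simp [mul_comm]
  have h := hw.dvd_of_walk_eq (Nat.gcd_dvd_right u.val k) (by rw [hgcd]; exact hmul _)
  have h0 : u.val = 0 :=
    Nat.eq_zero_of_dvd_of_lt (Nat.gcd_eq_right_iff_dvd.1 h) u.val_lt
  exact (ZMod.val_eq_zero u).1 h0

theorem walk_injective (hw : Word.Primitive (walk s 0 k)) {i j : ZMod k}
    (h : walk s i k = walk s j k) : i = j := by
  rw [walk_eq_walk_iff] at h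
  refine (sub_eq_zero.1 (eq_zero_of_period hw (i - j) fun x => ?_))
  have := h (x - j).val (x - j).val_lt
  rw [ZMod.natCast_zmod_val] at this
  rw [show x + (i - j) = i + (x - j) by ring, this]
  congr 1
  ring

/-- If a primitive word can be read sufficiently often in succession along a primitive cyclic word,
then it is a rotation of this cyclic word. -/
theorem length_eq_of_walk_repeat (hw : Word.Primitive (walk s 0 k)) {b : Word d}
    (hb : b.Primitive) (i : ZMod k)
    (h : ∀ q ≤ k, walk s (i + (q * b.length : ℕ)) b.length = b) : b.length = k := by
  set l := b.length with hl
  have hlpos : 0 < l := List.length_pos_of_ne_nil hb.1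
  -- Position `i + t` with `t < k` lies in copy number `t / l < k` of `b`, so a next copy exists,
  -- and comparing the two shifts by `l`.
  have hper : ∀ j, s (j + l) = s j := by
    intro j
    obtain ⟨t, ht, rfl⟩ : ∃ t : ℕ, t < k ∧ j = i + t :=
      ⟨(j - i).val, (j - i).val_lt, by rw [ZMod.natCast_zmod_val]; ring⟩
    have hq : t / l + 1 ≤ k := (Nat.div_le_self t l).trans_lt ht
    have h1 := (h _ (Nat.le_of_succ_le hq)).trans (h _ hq).symm
    rw [walk_eq_walk_iff] at h1
    have h2 := h1 (t % l) (Nat.mod_lt _ hlpos)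
    have ht' : (t : ZMod k) = (t / l * l : ℕ) + (t % l : ℕ) := by
      rw [← Nat.cast_add, Nat.div_add_mod']
    rw [ht', ← add_assoc, h2]
    congr 1
    push_cast
    ring
  -- The cycle has no nontrivial period, so `k ∣ l`; conversely `k` is a period of the primitive
  -- word `b`, so `l = k`.
  have hdvd : k ∣ l := (ZMod.natCast_eq_zero_iff l k).1 (eq_zero_of_period hw _ hper)
  have hbw : walk s i l = b := by simpa using h 0 (Nat.zero_le _)
  rw [← hbw] at hb
  exact (hb.dvd_of_walk_eq hdvd (by simp)).symm

end Primitive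

open Polynomial Matrix

/-! ### The polynomial `det (1 + z A)` -/

/-- The polynomial `det (1 + z A)` in the variable `z`. -/
def detOneAdd {ι S : Type*} [Fintype ι] [DecidableEq ι] [CommRing S] (A : Matrix ι ι S) : S[X] :=
  (1 + (X : S[X]) • A.map C).det

section DetOneAdd

variable {ι κ S : Type*} [Fintype ι] [DecidableEq ι] [Fintype κ] [DecidableEq κ] [CommRing S]

theorem detOneAdd_eq_charpolyRev (A : Matrix ι ι S) : detOneAdd A = (-A).charpolyRev := by
  unfold detOneAdd charpolyRev
  congr 1
  ext1 i j
  simp [sub_eq_add_neg]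

@[simp]
theorem detOneAdd_zero : detOneAdd (0 : Matrix ι ι S) = 1 := by
  simp [detOneAdd]

theorem detOneAdd_transpose (A : Matrix ι ι S) : detOneAdd Aᵀ = detOneAdd A := by
  unfold detOneAdd
  rw [← det_transpose]
  congr 1
  ext1 i j
  simp [one_apply, eq_comm]

theorem detOneAdd_mul_comm (A B : Matrix ι ι S) : detOneAdd (A * B) = detOneAdd (B * A) := by
  unfold detOneAdd
  rw [Matrix.map_mul, Matrix.map_mul, ← Matrix.smul_mul, det_one_add_mul_comm,
    Matrix.mul_smul]

theorem detOneAdd_fromBlocks (A : Matrix ι ι S) (B : Matrix κ κ S) :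
    detOneAdd (fromBlocks A 0 0 B) = detOneAdd A * detOneAdd B := by
  unfold detOneAdd
  rw [fromBlocks_map, ← fromBlocks_one, fromBlocks_smul, fromBlocks_add]
  simp [det_fromBlocks_zero₂₁]

theorem detOneAdd_reindex (e : ι ≃ κ) (A : Matrix ι ι S) :
    detOneAdd (reindex e e A) = detOneAdd A := by
  unfold detOneAdd
  rw [← det_reindex_self e]
  congr 1
  ext1 i j
  simp [one_apply]

theorem detOneAdd_diagonal (v : ι → S) : detOneAdd (diagonal v) = ∏ i, (1 + C (v i) * X) := by
  unfold detOneAdd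
  rw [← det_diagonal]
  congr 1
  ext1 i j
  by_cases h : i = j
  · subst h; simp [Polynomial.X_mul_C]
  · simp [h]

/-- The reversed characteristic polynomial of a nilpotent matrix is a unit, hence constant over a
domain, with value `1` at zero. -/
theorem detOneAdd_of_isNilpotent [IsDomain S] {A : Matrix ι ι S} (hA : IsNilpotent A) :
    detOneAdd A = 1 := by
  rw [detOneAdd_eq_charpolyRev]
  obtain ⟨r, -, hr⟩ := Polynomial.isUnit_iff.1 (isUnit_charpolyRev_of_isNilpotent hA.neg)
  have h := eval_charpolyRev (M := -A)
  rw [← hr, eval_C] at h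
  rw [← hr, h, C_1]

theorem sigma_eq_coeff_detOneAdd [Nontrivial S] {n t : ℕ} (ht : t ≤ n)
    (A : Matrix (Fin n) (Fin n) S) : sigma t A = (detOneAdd A).coeff t := by
  rw [detOneAdd_eq_charpolyRev, ← reverse_charpoly, coeff_reverse, charpoly_natDegree_eq_dim,
    Fintype.card_fin, revAt_le ht, sigma, sigmaPoly_eq_charpoly]

/-- This matches the convention `σ_t(α) ↦ 0` for `t > n`, so coefficients of `detOneAdd` describe
`Psi` uniformly in `t`. -/
theorem coeff_detOneAdd_eq_zero [Nontrivial S] {n t : ℕ} (ht : n < t)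
    (A : Matrix (Fin n) (Fin n) S) : (detOneAdd A).coeff t = 0 := by
  rw [detOneAdd_eq_charpolyRev, ← reverse_charpoly]
  refine coeff_eq_zero_of_natDegree_lt ((reverse_natDegree_le _).trans_lt ?_)
  rwa [charpoly_natDegree_eq_dim, Fintype.card_fin]

theorem detOneAdd_map {T : Type*} [CommRing T] (f : S →+* T) (A : Matrix ι ι S) :
    detOneAdd (A.map f) = (detOneAdd A).map f := by
  unfold detOneAdd
  rw [← coe_mapRingHom, RingHom.map_det]
  congr 1
  ext1 i j
  by_cases h : i = j
  · subst h; simp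
  · simp [h]

end DetOneAdd

/-! ### Families of matrices indexed by letters -/

/-- The product of matrices along a word. -/
def evalWord {ι S : Type*} [Fintype ι] [DecidableEq ι] [CommRing S] {d : ℕ}
    (M : Letter d → Matrix ι ι S) (w : Word d) : Matrix ι ι S :=
  (w.map M).prod

section EvalWord

variable {ι κ S : Type*} [Fintype ι] [DecidableEq ι] [Fintype κ] [DecidableEq κ] [CommRing S]
  {d : ℕ}

@[simp]
theorem evalWord_nil (M : Letter d → Matrix ι ι S) : evalWord M [] = 1 := rfl

@[simp]
theorem evalWord_cons (M : Letter d → Matrix ι ι S) (l : Letter d) (w : Word d) :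
    evalWord M (l :: w) = M l * evalWord M w := by
  simp [evalWord]

theorem evalWord_fromBlocks (M : Letter d → Matrix ι ι S) (N : Letter d → Matrix κ κ S)
    (w : Word d) :
    evalWord (fun l => fromBlocks (M l) 0 0 (N l)) w =
      fromBlocks (evalWord M w) 0 0 (evalWord N w) := by
  induction w with
  | nil => simp
  | cons l w ih => simp [ih, fromBlocks_multiply]

theorem evalWord_conj (M : Letter d → Matrix ι ι S) {P Q : Matrix ι ι S} (h : Q * P = 1)
    (w : Word d) : evalWord (fun l => P * M l * Q) w = P * evalWord M w * Q := by
  induction w with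
  | nil => simpa using (mul_eq_one_comm.1 h).symm
  | cons l w ih =>
    rw [evalWord_cons, ih, evalWord_cons]
    calc P * M l * Q * (P * evalWord M w * Q) = P * M l * (Q * P) * evalWord M w * Q := by
          simp only [Matrix.mul_assoc]
      _ = _ := by rw [h]; simp only [Matrix.mul_assoc, Matrix.mul_one]

theorem evalWord_reindex (e : ι ≃ κ) (M : Letter d → Matrix ι ι S) (w : Word d) :
    evalWord (fun l => reindex e e (M l)) w = reindex e e (evalWord M w) := by
  induction w with
  | nil => simp
  | cons l w ih =>
    rw [evalWord_cons, ih, evalWord_cons]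
    simp only [reindex_apply, submatrix_mul_equiv]

theorem evalWord_transpose_tr (M : Letter d → Matrix ι ι S) (w : Word d) :
    evalWord (fun l => (M l.tr)ᵀ) w = (evalWord M w.tr)ᵀ := by
  unfold evalWord Word.tr
  rw [Matrix.transpose_list_prod, List.map_reverse, List.map_reverse, List.reverse_reverse,
    List.map_map, List.map_map]
  rfl

/-- If `-1` is a square and `2` is invertible, then every family of matrices indexed by letters is
part of an orthogonal family of twice the size: one in which transposed letters act by transposed
matrices. -/
theorem exists_orthogonal_family {ι K : Type*} [Fintype ι] [DecidableEq ι] [Field K]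
    (h2 : (2 : K) ≠ 0) {I : K} (hI : I * I = -1) (M : Letter d → Matrix ι ι K) :
    ∃ Y : Letter d → Matrix (ι ⊕ ι) (ι ⊕ ι) K, (∀ l, Y l.tr = (Y l)ᵀ) ∧
      ∀ w : Word d, detOneAdd (evalWord Y w) =
        detOneAdd (evalWord M w) * detOneAdd (evalWord M w.tr) := by
  let J : Matrix (ι ⊕ ι) (ι ⊕ ι) K := fromBlocks 0 1 1 0
  -- The columns `(1, I)` and `(1/2, -I/2)` form a hyperbolic pair for the standard form, so `P`
  -- carries `J` to the standard form.
  let P : Matrix (ι ⊕ ι) (ι ⊕ ι) K :=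
    fromBlocks 1 ((1 / 2 : K) • 1) (I • 1) ((-I / 2 : K) • 1)
  let D : Letter d → Matrix (ι ⊕ ι) (ι ⊕ ι) K := fun l => fromBlocks (M l) 0 0 (M l.tr)ᵀ
  have hJJ : J * J = 1 := by simp [J, fromBlocks_multiply]
  have hJt : Jᵀ = J := by simp [J, fromBlocks_transpose]
  have hPP : Pᵀ * P = J := by
    have h : Pᵀ * P = fromBlocks ((1 + I * I) • 1) ((1 / 2 + -I / 2 * I) • 1)
        ((1 / 2 + I * (-I / 2)) • 1) ((1 / 2 * (1 / 2) + -I / 2 * (-I / 2)) • 1) := by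
      simp only [P, fromBlocks_transpose, fromBlocks_multiply, transpose_smul, transpose_one,
        Matrix.mul_smul, Matrix.mul_one, smul_smul, add_smul, one_smul]
    rw [h, show 1 + I * I = 0 by rw [hI]; ring,
      show 1 / 2 + I * (-I / 2) = 1 by field_simp; linear_combination -hI,
      show 1 / 2 + -I / 2 * I = 1 by field_simp; linear_combination -hI,
      show 1 / 2 * (1 / 2) + -I / 2 * (-I / 2) = 0 by field_simp; linear_combination hI]
    simp [J]
  have hQP : J * Pᵀ * P = 1 := by rw [Matrix.mul_assoc, hPP, hJJ]
  refine ⟨fun l => P * D l * (J * Pᵀ), fun l => ?_, fun w => ?_⟩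
  -- `D l.tr` is the adjoint of `D l` for the form `J`; conjugation by `P` turns this adjoint into
  -- the transpose.
  · have hD : D l.tr = J * (D l)ᵀ * J := by
      simp [D, J, fromBlocks_transpose, fromBlocks_multiply, Letter.tr_tr]
    simp only [hD, transpose_mul, transpose_transpose, hJt]
    calc P * (J * (D l)ᵀ * J) * (J * Pᵀ) = P * J * (D l)ᵀ * (J * J) * Pᵀ := by
          simp only [Matrix.mul_assoc]
      _ = _ := by rw [hJJ]; simp only [Matrix.mul_assoc, Matrix.one_mul]
  · rw [evalWord_conj D hQP, detOneAdd_mul_comm, ← Matrix.mul_assoc, hQP, Matrix.one_mul,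
      evalWord_fromBlocks, detOneAdd_fromBlocks, evalWord_transpose_tr, detOneAdd_transpose]

end EvalWord

/-! ### Representations of the cyclic quiver -/

/-- The matrix of a letter on the cycle labelled by `s`: the letter `l` moves along the edges
labelled by `l`, with weight `x`. -/
def cycleMatrix {K : Type*} [CommRing K] {d k : ℕ} (s : ZMod k → Letter d) (x : K)
    (l : Letter d) : Matrix (ZMod k) (ZMod k) K :=
  of fun i j => if j = i + 1 ∧ s i = l then x else 0

section Cycle

variable {K : Type*} {d k : ℕ} [NeZero k] (s : ZMod k → Letter d)

/-- Each vertex has a single outgoing edge, so only one path of the given length starts at `i`. -/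
theorem evalWord_cycleMatrix [CommRing K] (x : K) (b : Word d) (i j : ZMod k) :
    evalWord (cycleMatrix s x) b i j =
      if j = i + (b.length : ℕ) ∧ walk s i b.length = b then x ^ b.length else 0 := by
  induction b generalizing i with
  | nil => simp [walk, one_apply, eq_comm]
  | cons l b ih =>
    rw [evalWord_cons, mul_apply, Finset.sum_eq_single (i + 1)]
    · rw [ih]
      simp only [cycleMatrix, of_apply, true_and, List.length_cons, walk, List.cons.injEq]
      push_cast
      rw [add_assoc, add_comm (1 : ZMod k)]
      by_cases h1 : s i = l <;> simp [h1, pow_succ']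
    · intro j' _ hj'
      simp [cycleMatrix, hj']
    · simp

theorem walk_of_evalWord_pow_ne_zero [CommRing K] (x : K) (b : Word d) (r : ℕ) (i j : ZMod k)
    (h : (evalWord (cycleMatrix s x) b ^ r) i j ≠ 0) :
    ∀ q < r, walk s (i + (q * b.length : ℕ)) b.length = b := by
  induction r generalizing i with
  | zero => simp
  | succ r ih =>
    rw [pow_succ', mul_apply] at h
    obtain ⟨j', -, hj'⟩ := Finset.exists_ne_zero_of_sum_ne_zero h
    have h1 := left_ne_zero_of_mul hj'
    rw [evalWord_cycleMatrix] at h1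
    obtain ⟨rfl, hw⟩ := (ite_ne_right_iff.1 h1).1
    intro q hq
    cases q with
    | zero => simpa using hw
    | succ q =>
      have := ih _ (right_ne_zero_of_mul hj') q (by omega)
      rw [add_assoc, ← Nat.cast_add] at this
      rwa [Nat.succ_mul, add_comm (q * _)]

/-- A rotation of the cyclic word is read from exactly one vertex, by primitivity, and returns
there. Any other primitive word cannot be read `k + 1` times in a row, so its matrix is nilpotent.
-/
theorem detOneAdd_cycleMatrix [Field K] (hs : Word.Primitive (walk s 0 k)) (x : K) {b : Word d}
    (hb : b.Primitive) : detOneAdd (evalWord (cycleMatrix s x) b) =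
      if List.IsRotated (walk s 0 k) b then 1 + C (x ^ k) * X else 1 := by
  split_ifs with h
  · obtain ⟨i, rfl⟩ := exists_walk_of_isRotated s h
    have : evalWord (cycleMatrix s x) (walk s i k) = diagonal (Pi.single i (x ^ k)) := by
      ext j j'
      rw [evalWord_cycleMatrix, length_walk, CharP.cast_eq_zero, add_zero]
      by_cases hj : j = j'
      · subst hj
        by_cases hi : j = i
        · subst hi; simp
        · have : walk s j k ≠ walk s i k := fun e => hi (walk_injective hs e)
          simp [hi, this]
      · simp [hj, Ne.symm hj]
    rw [this, detOneAdd_diagonal, Finset.prod_eq_single i]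
    · simp
    · intro j _ hj
      simp [hj]
    · simp
  · refine detOneAdd_of_isNilpotent ⟨k + 1, ?_⟩
    ext i j
    by_contra hne
    have hw := walk_of_evalWord_pow_ne_zero s x b (k + 1) i j hne
    have hl := length_eq_of_walk_repeat hs hb i fun q hq => hw q (Nat.lt_succ_of_le hq)
    have h0 : walk s i k = b := by simpa [hl] using hw 0 (Nat.succ_pos k)
    exact h (h0 ▸ isRotated_walk s i)

end Cycle

/-! ### Realizable families of polynomials -/

/-- A family of polynomials indexed by words is realizable if, on primitive words, it is given by
`det (1 + z M_w)` for some matrices `M_l` indexed by the letters. -/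
def Realizable {K : Type*} [Field K] {d : ℕ} (G : Word d → K[X]) : Prop :=
  ∃ (ι : Type) (_ : Fintype ι) (_ : DecidableEq ι) (_ : Nonempty ι)
    (M : Letter d → Matrix ι ι K), ∀ w : Word d, w.Primitive → detOneAdd (evalWord M w) = G w

namespace Realizable

variable {K : Type*} [Field K] {d : ℕ}

theorem one : Realizable (fun _ : Word d => (1 : K[X])) := by
  refine ⟨Unit, inferInstance, inferInstance, inferInstance, fun _ => 0, fun w hw => ?_⟩
  obtain ⟨l, w, rfl⟩ := List.exists_cons_of_ne_nil hw.1
  simp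

theorem mul {G H : Word d → K[X]} (hG : Realizable G) (hH : Realizable H) :
    Realizable (fun w => G w * H w) := by
  obtain ⟨ι, _, _, _, M, hM⟩ := hG
  obtain ⟨κ, _, _, _, N, hN⟩ := hH
  refine ⟨ι ⊕ κ, inferInstance, inferInstance, inferInstance,
    fun l => fromBlocks (M l) 0 0 (N l), fun w hw => ?_⟩
  rw [evalWord_fromBlocks, detOneAdd_fromBlocks, hM w hw, hN w hw]

theorem prod {γ : Type*} (s : Finset γ) {G : γ → Word d → K[X]}
    (hG : ∀ c ∈ s, Realizable (G c)) : Realizable (fun w => ∏ c ∈ s, G c w) := by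
  classical
  induction s using Finset.induction_on with
  | empty => simpa using one
  | insert c s hc ih =>
    simp only [Finset.prod_insert hc]
    exact (hG c (Finset.mem_insert_self c s)).mul
      (ih fun c' h => hG c' (Finset.mem_insert_of_mem h))

theorem linear [IsAlgClosed K] {a : Word d} (ha : a.Primitive) (y : K) :
    Realizable (fun w => if List.IsRotated a w then 1 + C y * X else 1) := by
  obtain ⟨s, hs⟩ := exists_walk_eq a ha.1
  have hk : 0 < a.length := List.length_pos_of_ne_nil ha.1
  have : NeZero a.length := ⟨hk.ne'⟩
  obtain ⟨x, hx⟩ := IsAlgClosed.exists_pow_nat_eq y hk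
  refine ⟨ZMod a.length, inferInstance, inferInstance, inferInstance, cycleMatrix s x,
    fun w hw => ?_⟩
  rw [detOneAdd_cycleMatrix s (hs.symm ▸ ha) x hw, hs, hx]

theorem polynomial [IsAlgClosed K] {a : Word d} (ha : a.Primitive) {q : K[X]}
    (hq : q.coeff 0 = 1) : Realizable (fun w => if List.IsRotated a w then q else 1) := by
  induction hn : q.natDegree generalizing q with
  | zero =>
    rw [eq_C_of_natDegree_eq_zero hn, hq]
    simpa using one
  | succ n ih =>
    have hq0 : q ≠ 0 := by rintro rfl; simp at hq
    obtain ⟨r, hr⟩ := IsAlgClosed.exists_root q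
      (by rw [degree_eq_natDegree hq0, hn]; exact_mod_cast Nat.succ_ne_zero n)
    obtain ⟨g, rfl⟩ := dvd_iff_isRoot.2 hr
    rw [mul_coeff_zero, coeff_sub, coeff_X_zero, coeff_C_zero, zero_sub] at hq
    have hr0 : r ≠ 0 := by rintro rfl; simp at hq
    have hg0 : g ≠ 0 := by rintro rfl; simp at hq
    -- Each root factor is normalised to constant term `1`, the scalar `-r` going to the cofactor.
    have h1 : (X - C r) * g = (1 + C (-r⁻¹) * X) * (C (-r) * g) := by
      have : C r⁻¹ * C r = (1 : K[X]) := by rw [← C_mul, inv_mul_cancel₀ hr0, C_1]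
      simp only [C_neg]
      linear_combination (-X * g) * this
    have h2 : (C (-r) * g).natDegree = n := by
      rw [natDegree_mul (X_sub_C_ne_zero r) hg0, natDegree_X_sub_C] at hn
      rw [natDegree_C_mul (neg_ne_zero.2 hr0)]
      omega
    convert (linear ha (-r⁻¹)).mul (ih (q := C (-r) * g) (by simpa using hq) h2) using 2 with w
    split_ifs
    · exact h1
    · simp

end Realizable

/-- A truncated power series with constant term `1` has an `e`-th root for `e` invertible. -/
theorem exists_pow_coeff_eq {K : Type*} [Field K] {e : ℕ} (he : (e : K) ≠ 0) (y : ℕ → K)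
    (m : ℕ) : ∃ q : K[X], q.coeff 0 = 1 ∧ ∀ t, 0 < t → t ≤ m → (q ^ e).coeff t = y t := by
  induction m with
  | zero => exact ⟨1, by simp, fun t h h' => by omega⟩
  | succ m ih =>
    obtain ⟨q, hq0, hq⟩ := ih
    set c : K := (y (m + 1) - (q ^ e).coeff (m + 1)) / e with hc
    -- Adding `c X ^ (m + 1)` leaves the lower coefficients of the power unchanged and adds `e * c`
    -- in degree `m + 1`.
    have key : ∀ n : ℕ, ∃ g : K[X], (q + C c * X ^ (m + 1)) ^ n =
        q ^ n + X ^ (m + 1) * g ∧ g.coeff 0 = n * c := by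
      intro n
      induction n with
      | zero => exact ⟨0, by simp⟩
      | succ n ihn =>
        obtain ⟨g, hg, hg0⟩ := ihn
        refine ⟨g * (q + C c * X ^ (m + 1)) + q ^ n * C c, ?_, ?_⟩
        · rw [pow_succ, hg]; ring
        · rw [coeff_zero_eq_eval_zero] at hg0 hq0 ⊢
          simp [hg0, hq0]
          ring
    obtain ⟨g, hg, hg0⟩ := key e
    refine ⟨q + C c * X ^ (m + 1), by simp [hq0], fun t h h' => ?_⟩
    rw [hg, coeff_add, coeff_X_pow_mul']
    rcases Nat.lt_or_ge m t with ht | ht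
    · obtain rfl : t = m + 1 := by omega
      rw [if_pos le_rfl, Nat.sub_self, hg0, hc]
      field_simp
      ring
    · rw [if_neg (by omega), add_zero, hq t h ht]

/-! ### Transposes of words and representatives of classes -/

theorem Word.tr_append {d : ℕ} (u v : Word d) :
    Word.tr (u ++ v) = Word.tr v ++ Word.tr u := by
  simp [Word.tr]

theorem Word.tr_pow {d : ℕ} (u : Word d) (l : ℕ) : Word.tr (u.pow l) = u.tr.pow l := by
  induction l with
  | zero => simp [Word.pow, Word.tr]
  | succ l ih =>
    unfold Word.pow at ih ⊢
    rw [List.replicate_succ, List.flatten_cons, Word.tr_append, ih, List.replicate_succ',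
      List.flatten_append, List.flatten_singleton]

theorem Word.length_tr {d : ℕ} (w : Word d) : (Word.tr w).length = w.length := by
  simp [Word.tr]

theorem Word.Primitive.tr {d : ℕ} {w : Word d} (hw : w.Primitive) : (Word.tr w).Primitive := by
  refine ⟨fun h => hw.1 ?_, fun u hu l h => hw.2 u.tr ?_ l ?_⟩
  · rw [← Word.tr_tr w, h]; rfl
  · rwa [Word.length_tr, ← Word.length_tr w]
  · rw [← Word.tr_pow, ← h, Word.tr_tr]

/-- A primitive word representing a class. -/
def PrimClass.rep {d : ℕ} (c : PrimClass d) : Prim d :=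
  Quotient.out (s := primSetoid d) c

theorem PrimClass.mk_rep {d : ℕ} (c : PrimClass d) : PrimClass.mk c.rep = c :=
  Quotient.out_eq (s := primSetoid d) c

theorem PrimClass.eq_of_equivalent {d : ℕ} {c c' : PrimClass d}
    (h : Word.Equivalent c.rep.1 c'.rep.1) : c = c' := by
  rw [← c.mk_rep, ← c'.mk_rep]
  exact Quotient.sound (s := primSetoid d) h

/-! ### Evaluation of free relations -/

section Evaluation

variable {F K : Type*} [Field F] [Field K] [Algebra F K] {d n : ℕ}

theorem map_wordMatrix (Y : Letter d → Matrix (Fin n) (Fin n) K)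
    (hY : ∀ l, Y l.tr = (Y l)ᵀ) (w : Word d) :
    (wordMatrix F n w).map
      (MvPolynomial.aeval (R := F) fun v : Fin d × Fin n × Fin n =>
        Y (v.1, false) v.2.1 v.2.2) = evalWord Y w := by
  induction w with
  | nil => simp [wordMatrix]
  | cons l w ih =>
    have h : wordMatrix F n (l :: w) = letterMatrix F n l * wordMatrix F n w := by
      simp [wordMatrix]
    rw [h, Matrix.map_mul, ih, evalWord_cons]
    congr 1
    obtain ⟨i, c⟩ := l
    cases c
    · ext; simp [letterMatrix, genericMatrix]
    · rw [show ((i, true) : Letter d) = Letter.tr (i, false) from rfl, hY]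
      ext; simp [letterMatrix, genericMatrix, Letter.tr]

theorem coe_genImage_mk (t : ℕ+) (a : Prim d) :
    (genImage F n (t, PrimClass.mk a) : GenRing F n d) =
      if (t : ℕ) ≤ n then sigma t (wordMatrix F n a.1) else 0 := by
  change Subtype.val (if h : (t : ℕ) ≤ n then
    (⟨sigma t (wordMatrix F n a.1), _⟩ : matrixInvariants F n d) else 0) = _
  split_ifs <;> rfl

theorem aeval_genImage (Y : Letter d → Matrix (Fin n) (Fin n) K)
    (hY : ∀ l, Y l.tr = (Y l)ᵀ) (q : ℕ+ × PrimClass d) :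
    MvPolynomial.aeval (R := F) (fun v : Fin d × Fin n × Fin n => Y (v.1, false) v.2.1 v.2.2)
      (genImage F n q : GenRing F n d) = (detOneAdd (evalWord Y q.2.rep.1)).coeff q.1 := by
  obtain ⟨t, c⟩ := q
  conv_lhs => rw [← c.mk_rep]
  rw [← map_wordMatrix (F := F) Y hY]
  rw [coe_genImage_mk]
  split_ifs with h
  · rw [sigma_eq_coeff_detOneAdd h, ← RingHom.coe_coe, detOneAdd_map, coeff_map]
  · rw [coeff_detOneAdd_eq_zero (not_le.1 h)]
    exact map_zero _

/-- Free relations vanish at the coefficients of `det (1 + z Y_α)`, for all matrices `Y_i`. -/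
theorem aeval_eq_zero_of_mem_freeRelations (hn : 0 < n)
    (Y : Letter d → Matrix (Fin n) (Fin n) K) (hY : ∀ l, Y l.tr = (Y l)ᵀ)
    {f : NSigma F d} (hf : f ∈ freeRelations F d) :
    MvPolynomial.aeval (fun q : ℕ+ × PrimClass d =>
      (detOneAdd (evalWord Y q.2.rep.1)).coeff q.1) f = 0 := by
  have h0 : Psi F n d f = 0 := by
    have h : f ∈ relations F n d := (Submodule.mem_iInf _).1 ((Submodule.mem_iInf _).1 hf n) hn
    exact h
  let φ : GenRing F n d →ₐ[F] K :=
    MvPolynomial.aeval fun v : Fin d × Fin n × Fin n => Y (v.1, false) v.2.1 v.2.2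
  have h : MvPolynomial.aeval (fun q : ℕ+ × PrimClass d =>
      (detOneAdd (evalWord Y q.2.rep.1)).coeff q.1) =
      φ.comp ((matrixInvariants F n d).val.comp (Psi F n d)) := by
    refine MvPolynomial.algHom_ext fun q => ?_
    simp only [MvPolynomial.aeval_X, AlgHom.comp_apply, Psi]
    exact (aeval_genImage Y hY q).symm
  rw [h, AlgHom.comp_apply, AlgHom.comp_apply, h0, map_zero, map_zero]

end Evaluation

/-! ### Prescribing the values of the generators -/

theorem Realizable.exists_orthogonal {K : Type*} [Field K] (h2 : (2 : K) ≠ 0) {I : K}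
    (hI : I * I = -1) {d : ℕ} {G : Word d → K[X]} (hG : Realizable G) :
    ∃ (n : ℕ) (_ : 0 < n) (Y : Letter d → Matrix (Fin n) (Fin n) K), (∀ l, Y l.tr = (Y l)ᵀ) ∧
      ∀ w : Word d, w.Primitive → detOneAdd (evalWord Y w) = G w * G w.tr := by
  obtain ⟨ι, _, _, _, M, hM⟩ := hG
  obtain ⟨Y, hY, hdet⟩ := exists_orthogonal_family h2 hI M
  let e := Fintype.equivFin (ι ⊕ ι)
  refine ⟨_, Fintype.card_pos, fun l => reindex e e (Y l), fun l => ?_, fun w hw => ?_⟩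
  · simp only [hY, transpose_reindex]
  · rw [evalWord_reindex, detOneAdd_reindex, hdet, hM w hw, hM _ hw.tr]

/-- Finitely many of the values of the generators `σ_t(α)` can be prescribed arbitrarily. -/
theorem exists_orthogonal_coeff_eq {K : Type*} [Field K] [IsAlgClosed K] (h2 : (2 : K) ≠ 0)
    {d : ℕ} (s : Finset (ℕ+ × PrimClass d)) (y : ℕ+ × PrimClass d → K) :
    ∃ (n : ℕ) (_ : 0 < n) (Y : Letter d → Matrix (Fin n) (Fin n) K), (∀ l, Y l.tr = (Y l)ᵀ) ∧
      ∀ q ∈ s, (detOneAdd (evalWord Y q.2.rep.1)).coeff q.1 = y q := by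
  classical
  obtain ⟨I, hI⟩ := IsAlgClosed.exists_pow_nat_eq (-1 : K) (n := 2) two_pos
  rw [sq] at hI
  -- The exponent counts how often the factor of `c` occurs in `G w * G w.tr` at `w = c.rep`: twice
  -- if `w` is a rotation of its transpose, otherwise once.
  let e : PrimClass d → ℕ := fun c => if List.IsRotated c.rep.1 (Word.tr c.rep.1) then 2 else 1
  have he : ∀ c, (e c : K) ≠ 0 := fun c => by
    simp only [e]; split_ifs
    · exact_mod_cast h2
    · simp
  -- The value `0` at `t = 0` is a dummy: only coefficients of positive degree are prescribed.
  choose Q hQ0 hQ using fun c => exists_pow_coeff_eq (he c)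
    (fun t => if h : 0 < t then y (⟨t, h⟩, c) else 0) (s.sup fun q => (q.1 : ℕ))
  obtain ⟨n, hn, Y, hY, hdet⟩ := Realizable.exists_orthogonal h2 hI
    (Realizable.prod (s.image Prod.snd) fun c _ => Realizable.polynomial c.rep.2 (hQ0 c))
  refine ⟨n, hn, Y, hY, fun q hq => ?_⟩
  obtain ⟨t, c⟩ := q
  have hc : c ∈ s.image Prod.snd := Finset.mem_image_of_mem _ hq
  rw [hdet _ c.rep.2, Finset.prod_eq_single_of_mem c hc, Finset.prod_eq_single_of_mem c hc,
    if_pos (List.IsRotated.refl _)]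
  · have h := hQ c t t.pos (Finset.le_sup (f := fun q : ℕ+ × PrimClass d => (q.1 : ℕ)) hq)
    rw [dif_pos t.pos] at h
    refine Eq.trans ?_ h
    congr 1
    simp only [e]
    split_ifs <;> simp [sq]
  · exact fun c' _ hne => if_neg fun h => hne (PrimClass.eq_of_equivalent (Or.inr h))
  · exact fun c' _ hne => if_neg fun h => hne (PrimClass.eq_of_equivalent (Or.inl h))

/-- There are no nonzero free relations in characteristic different from two. -/
theorem freeRelations_eq_bot (F : Type*) [Field F] (h2 : (2 : F) ≠ 0) (d : ℕ) :
    freeRelations F d = ⊥ := by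
  refine (Submodule.eq_bot_iff _).2 fun f hf => ?_
  -- `K` contains `N_σ`, so the symbols themselves serve as the values to be attained.
  let K := AlgebraicClosure (FractionRing (NSigma F d))
  let ψ : NSigma F d →ₐ[F] K :=
    (IsScalarTower.toAlgHom F (FractionRing (NSigma F d)) K).comp
      (IsScalarTower.toAlgHom F (NSigma F d) (FractionRing (NSigma F d)))
  have hψ : Function.Injective ψ :=
    (algebraMap (FractionRing (NSigma F d)) K).injective.comp
      (IsFractionRing.injective (NSigma F d) (FractionRing (NSigma F d)))
  have h2K : (2 : K) ≠ 0 := by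
    have := (map_ne_zero (algebraMap F K)).2 h2
    rwa [map_ofNat] at this
  obtain ⟨n, hn, Y, hY, hcoeff⟩ :=
    exists_orthogonal_coeff_eq h2K f.vars fun q => ψ (MvPolynomial.X q)
  -- On the variables of `f` the evaluation agrees with `ψ`, so the vanishing value is `ψ f`.
  refine hψ ?_
  rw [map_zero, ← aeval_eq_zero_of_mem_freeRelations hn Y hY hf,
    MvPolynomial.aeval_unique ψ]
  refine MvPolynomial.eval₂Hom_congr' rfl (fun q hq _ => ?_) rfl
  exact (hcoeff q hq).symm

end OInv

end

theorem mainTheorem3 (F : Type*) [Field F] [Infinite F] (p : ℕ) [CharP F p] (hp : p ≠ 2) (d : ℕ) :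
    (0 < p → OInv.freeRelations F d ≤
      Ideal.span {f | ∃ (t : ℕ+) (a : OInv.Prim d), f = OInv.NSigma.gen F t a ^ p}) ∧
    (p = 0 → OInv.freeRelations F d = ⊥) ∧
    (∀ f ∈ OInv.freeRelations F d, f ∈ OInv.decomposables F d) ∧
    (∀ f ∈ Submodule.span F {g | ∃ (t : ℕ+) (a : OInv.Prim d), g = OInv.NSigma.gen F t a},
      f ∈ OInv.freeRelations F d → f = 0) := by
  have h2 : (2 : F) ≠ 0 := Ring.two_ne_zero (by rwa [ringChar.eq F p])
  have h := OInv.freeRelations_eq_bot F h2 d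
  refine ⟨fun _ => h ▸ bot_le, fun _ => h, fun f hf => ?_, fun f _ hf => ?_⟩
  · rw [h, Submodule.mem_bot] at hf
    exact hf ▸ Submodule.zero_mem _
  · rwa [h, Submodule.mem_bot] at hf
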